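/- A group $G$ is called \emph{$\omega$-categorical} if its complete first-order theory in the language of groups has, up to isomorphism, a unique countable model (in particular finite groups are $\omega$-categorical). Let $p>3$ be a prime and let $G$ be an $\omega$-categorical group of exponent $p$ such that every subgroup of $G$ generated by at most $3$ elements is nilpotent of class at most $3$. Then $G$ is nilpotent. -/

import Mathlib

open Cardinal

universe u

/-- The function symbols of the language of groups: multiplication, inversion and the unit. -/
inductive GroupFunc : ℕ → Type
  | mul : GroupFunc 2
  | inv : GroupFunc 1
  | one : GroupFunc 0

/-- The first-order language of groups `(·, ⁻¹, 1)`; it has no relation symbols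
(besides equality). -/
def groupLanguage : FirstOrder.Language.{0, 0} where
  Functions := GroupFunc
  Relations := fun _ => Empty

/-- Every group, viewed as a first-order structure for the language of groups. -/
@[reducible]
def groupStructure (G : Type u) [Group G] : groupLanguage.Structure G where
  funMap := fun {n} f =>
    match n, f with
    | _, GroupFunc.mul => fun x => x 0 * x 1
    | _, GroupFunc.inv => fun x => (x 0)⁻¹
    | _, GroupFunc.one => fun _ => 1
  RelMap := fun {_} r _ => nomatch r

/-- A group `G` is `ω`-categorical if its complete first-order theory, in the language of groups,
has up to isomorphism only one countably infinite model. (If `G` is finite, all models of its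
theory are isomorphic to `G`, and there is no infinite one: finite groups are `ω`-categorical.) -/
def IsOmegaCategoricalGroup (G : Type u) [Group G] : Prop :=
  letI : groupLanguage.Structure G := groupStructure G
  Cardinal.Categorical (ℵ₀ : Cardinal.{u}) (groupLanguage.completeTheory G)

/-- `G` is nilpotent, and its nilpotency class is at most `c`. -/
def IsNilpotentOfClassLE (G : Type u) [Group G] (c : ℕ) : Prop :=
  Group.IsNilpotent G ∧ Group.nilpotencyClass G ≤ c

open scoped commutatorElement

section ClassThree

variable {K : Type*} [Group K]

/-! In fact G has class at most 3. A weight-four commutator ⁅⁅⁅x, y⁆, z⁆, t⁆ dies when y = z or z =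
t, since three elements then generate everything. Linearising these identities makes it alternating
in x, y, z, t. Commuting the Jacobi identity for x, y, z with t gives three equal factors, so its
cube is trivial; its order also divides p > 3. -/

theorem upperCentralSeries_three_eq_top_iff :
    Subgroup.upperCentralSeries K 3 = ⊤ ↔ ∀ a b c d : K, ⁅⁅⁅a, b⁆, c⁆, d⁆ = 1 := by
  simp only [Subgroup.eq_top_iff', Subgroup.mem_upperCentralSeries_succ_iff,
    Subgroup.upperCentralSeries_zero, Subgroup.mem_bot]

theorem tripleCommutator_conj (h : ∀ a b c d : K, ⁅⁅⁅a, b⁆, c⁆, d⁆ = 1) (x y z g : K) :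
    g * ⁅⁅x, y⁆, z⁆ * g⁻¹ = ⁅⁅x, y⁆, z⁆ := by
  rw [← commutatorElement_eq_one_iff_mul_comm.mp (h x y z g), mul_inv_cancel_right]

theorem tripleCommutator_mul_right (h : ∀ a b c d : K, ⁅⁅⁅a, b⁆, c⁆, d⁆ = 1) (x y z t : K) :
    ⁅⁅x, y⁆, z * t⁆ = ⁅⁅x, y⁆, z⁆ * ⁅⁅x, y⁆, t⁆ := by
  rw [commutatorElement_mul_right_eq_mul_conj, mul_assoc, mul_assoc, ← mul_assoc z,
    tripleCommutator_conj h]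

theorem tripleCommutator_mul_middle (h : ∀ a b c d : K, ⁅⁅⁅a, b⁆, c⁆, d⁆ = 1) (x y z t : K) :
    ⁅⁅x, y * z⁆, t⁆ = ⁅⁅x, z⁆, t⁆ * ⁅⁅x, y⁆, t⁆ := by
  have hc : Commute ⁅y, ⁅x, z⁆⁆ t := by
    rw [← commutatorElement_inv]
    exact (commutatorElement_eq_one_iff_commute.mp (h x z y t)).inv_left
  have e : ⁅x, y * z⁆ = ⁅x, y⁆ * (⁅y, ⁅x, z⁆⁆ * ⁅x, z⁆) := by
    rw [commutatorElement_mul_right_eq_mul_conj, commutatorElement_def y]; group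
  rw [e, commutatorElement_mul_left_eq_conj_mul, commutatorElement_mul_left_eq_conj_mul,
    hc.commutator_eq, mul_one, tripleCommutator_conj h, tripleCommutator_conj h]

theorem tripleCommutator_mul_mul (h : ∀ a b c d : K, ⁅⁅⁅a, b⁆, c⁆, d⁆ = 1) (x y z : K) :
    ⁅⁅x, y * z⁆, y * z⁆ =
      ⁅⁅x, z⁆, y⁆ * ⁅⁅x, y⁆, y⁆ * ⁅⁅x, z⁆, z⁆ * ⁅⁅x, y⁆, z⁆ := by
  rw [tripleCommutator_mul_right h, tripleCommutator_mul_middle h, tripleCommutator_mul_middle h]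
  group

theorem tripleCommutator_swap (h : ∀ a b c d : K, ⁅⁅⁅a, b⁆, c⁆, d⁆ = 1) (x y z : K) :
    ⁅⁅y, x⁆, z⁆ = ⁅⁅x, y⁆, z⁆⁻¹ := by
  have hc : Commute ⁅z, ⁅x, y⁆⁆ ⁅x, y⁆ := by
    rw [← commutatorElement_inv]
    exact (commutatorElement_eq_one_iff_commute.mp (h x y z ⁅x, y⁆)).inv_left
  rw [← commutatorElement_inv x y, commutatorElement_inv_left, mul_assoc, hc.eq,
    inv_mul_cancel_left, commutatorElement_inv]

theorem tripleCommutator_jacobi (h : ∀ a b c d : K, ⁅⁅⁅a, b⁆, c⁆, d⁆ = 1) (x y z : K) :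
    ⁅⁅x, y⁆, z⁆ * ⁅⁅y, z⁆, x⁆ * ⁅⁅z, x⁆, y⁆ = 1 := by
  have inv_right (a b c : K) : ⁅⁅a, b⁆, c⁻¹⁆ = ⁅⁅a, b⁆, c⁆⁻¹ := by
    rw [eq_inv_iff_mul_eq_one, ← tripleCommutator_mul_right h]; simp
  simpa only [tripleCommutator_mul_right h, inv_right, tripleCommutator_conj h] using
    commutatorElement_commutatorElement_conj_mul x y z

end ClassThree

/-- Every three-generator subgroup has trivial left-normed commutators of weight four. -/
def ThreeGeneratorClassThree (G : Type*) [Group G] : Prop :=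
  ∀ x y z : G, ∀ a b c d : Subgroup.closure ({x, y, z} : Set G), ⁅⁅⁅a, b⁆, c⁆, d⁆ = 1

namespace ThreeGeneratorClassThree

variable {G : Type*} [Group G]

theorem of_isNilpotentOfClassLE
    (hclass : ∀ a b c : G, IsNilpotentOfClassLE (Subgroup.closure ({a, b, c} : Set G)) 3) :
    ThreeGeneratorClassThree G := by
  intro x y z
  obtain ⟨hn, hc⟩ := hclass x y z
  rw [← upperCentralSeries_three_eq_top_iff]
  exact Subgroup.upperCentralSeries_eq_top_iff_nilpotencyClass_le.mpr hc

/-- Any three elements lie in a common subgroup in which commutators of weight four are trivial. -/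
theorem exists_subgroup (h : ThreeGeneratorClassThree G) (x y z : G) :
    ∃ (K : Subgroup G) (X Y Z : K), (∀ a b c d : K, ⁅⁅⁅a, b⁆, c⁆, d⁆ = 1) ∧
      (X : G) = x ∧ (Y : G) = y ∧ (Z : G) = z :=
  ⟨Subgroup.closure {x, y, z}, ⟨x, Subgroup.subset_closure (by simp)⟩,
    ⟨y, Subgroup.subset_closure (by simp)⟩, ⟨z, Subgroup.subset_closure (by simp)⟩,
    h x y z, rfl, rfl, rfl⟩

theorem commutator_middle_eq_one (h : ThreeGeneratorClassThree G) (x y t : G) :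
    ⁅⁅⁅x, y⁆, y⁆, t⁆ = 1 := by
  obtain ⟨K, X, Y, T, hK, rfl, rfl, rfl⟩ := h.exists_subgroup x y t
  exact congrArg Subtype.val (hK X Y Y T)

theorem commutator_right_eq_one (h : ThreeGeneratorClassThree G) (x y z : G) :
    ⁅⁅⁅x, y⁆, z⁆, z⁆ = 1 := by
  obtain ⟨K, X, Y, Z, hK, rfl, rfl, rfl⟩ := h.exists_subgroup x y z
  exact congrArg Subtype.val (hK X Y Z Z)

/-- Linearises the vanishing at a repeated last entry, treating ⁅x, y⁆ as a single generator. -/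
theorem commutator_swap_right (h : ThreeGeneratorClassThree G) (x y z t : G) :
    ⁅⁅⁅x, y⁆, t⁆, z⁆ = ⁅⁅⁅x, y⁆, z⁆, t⁆⁻¹ := by
  obtain ⟨K, U, Z, T, hK, hU, rfl, rfl⟩ := h.exists_subgroup ⁅x, y⁆ z t
  have e := congrArg Subtype.val (tripleCommutator_mul_mul hK U Z T)
  change ⁅⁅(U : G), (Z : G) * (T : G)⁆, (Z : G) * (T : G)⁆ =
    ⁅⁅(U : G), (T : G)⁆, (Z : G)⁆ * ⁅⁅(U : G), (Z : G)⁆, (Z : G)⁆ *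
    ⁅⁅(U : G), (T : G)⁆, (T : G)⁆ * ⁅⁅(U : G), (Z : G)⁆, (T : G)⁆ at e
  rw [hU] at e
  simp only [h.commutator_right_eq_one, mul_one] at e
  exact eq_inv_of_mul_eq_one_left e.symm

theorem commutator_swap_left (h : ThreeGeneratorClassThree G) (x y z t : G) :
    ⁅⁅⁅y, x⁆, z⁆, t⁆ = ⁅⁅⁅x, y⁆, z⁆, t⁆⁻¹ := by
  obtain ⟨K, U, Z, T, hK, hU, rfl, rfl⟩ := h.exists_subgroup ⁅x, y⁆ z t
  have hU' : ⁅y, x⁆ = ((U⁻¹ : K) : G) := by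
    rw [← commutatorElement_inv, ← hU]; rfl
  have e : ⁅⁅U⁻¹, Z⁆, T⁆ = ⁅⁅U, Z⁆, T⁆⁻¹ := by
    rw [tripleCommutator_swap hK, eq_inv_iff_mul_eq_one.mpr
      ((tripleCommutator_mul_middle hK Z U U⁻¹ T).symm.trans (by simp)),
      ← tripleCommutator_swap hK]
  rw [hU', ← hU]
  exact congrArg Subtype.val e

/-- Lets t, outside the subgroup generated by x, y, z, be commuted with products of triple
commutators. -/
theorem commutator_mul_left (h : ThreeGeneratorClassThree G) {a x y : G} (t : G)
    (hc : Commute ⁅x, y⁆ a) : ⁅a * ⁅x, y⁆, t⁆ = ⁅⁅x, y⁆, t⁆ * ⁅a, t⁆ := by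
  -- Swapping t and a brings the trivial ⁅⁅x, y⁆, a⁆ inside.
  have e : ⁅⁅⁅x, y⁆, t⁆, a⁆ = 1 := by
    rw [h.commutator_swap_right, hc.commutator_eq, commutatorElement_one_left, inv_one]
  rw [commutatorElement_mul_left_eq_conj_mul,
    ← commutatorElement_eq_one_iff_mul_comm.mp e, mul_inv_cancel_right]

theorem commutator_swap_middle (h : ThreeGeneratorClassThree G) (x y z t : G) :
    ⁅⁅⁅x, z⁆, y⁆, t⁆ = ⁅⁅⁅x, y⁆, z⁆, t⁆⁻¹ := by
  obtain ⟨K, X, Y, Z, hK, rfl, rfl, rfl⟩ := h.exists_subgroup x y z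
  have hc (a b c a' b' c' : K) :
      Commute ⁅⁅(a : G), (b : G)⁆, (c : G)⁆ ⁅⁅(a' : G), (b' : G)⁆, (c' : G)⁆ :=
    commutatorElement_eq_one_iff_commute.mp (congrArg Subtype.val (hK a b c ⁅⁅a', b'⁆, c'⁆))
  have e := congrArg Subtype.val (tripleCommutator_mul_mul hK X Y Z)
  have e' := h.commutator_middle_eq_one (X : G) (Y * Z) t
  change ⁅⁅(X : G), (Y : G) * (Z : G)⁆, (Y : G) * (Z : G)⁆ =
    ⁅⁅(X : G), (Z : G)⁆, (Y : G)⁆ * ⁅⁅(X : G), (Y : G)⁆, (Y : G)⁆ *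
    ⁅⁅(X : G), (Z : G)⁆, (Z : G)⁆ * ⁅⁅(X : G), (Y : G)⁆, (Z : G)⁆ at e
  rw [e, h.commutator_mul_left t
      (((hc X Y Z X Z Y).mul_right (hc X Y Z X Y Y)).mul_right (hc X Y Z X Z Z)),
    h.commutator_mul_left t ((hc X Z Z X Z Y).mul_right (hc X Z Z X Y Y)),
    h.commutator_mul_left t (hc X Y Y X Z Y),
    h.commutator_middle_eq_one, h.commutator_middle_eq_one, one_mul, one_mul] at e'
  exact eq_inv_of_mul_eq_one_right e'

/-- Cyclic rotations of x, y, z are even, so alternation makes the three Jacobi terms agree after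
commuting with t. -/
theorem commutator_pow_three_eq_one (h : ThreeGeneratorClassThree G) (x y z t : G) :
    ⁅⁅⁅x, y⁆, z⁆, t⁆ ^ 3 = 1 := by
  have h₁ : ⁅⁅⁅y, z⁆, x⁆, t⁆ = ⁅⁅⁅x, y⁆, z⁆, t⁆ := by
    rw [h.commutator_swap_middle, h.commutator_swap_left, inv_inv]
  have h₂ : ⁅⁅⁅z, x⁆, y⁆, t⁆ = ⁅⁅⁅x, y⁆, z⁆, t⁆ := by
    rw [h.commutator_swap_left, h.commutator_swap_middle, inv_inv]
  obtain ⟨K, X, Y, Z, hK, rfl, rfl, rfl⟩ := h.exists_subgroup x y z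
  have hc (a b c a' b' c' : K) :
      Commute ⁅⁅(a : G), (b : G)⁆, (c : G)⁆ ⁅⁅(a' : G), (b' : G)⁆, (c' : G)⁆ :=
    commutatorElement_eq_one_iff_commute.mp (congrArg Subtype.val (hK a b c ⁅⁅a', b'⁆, c'⁆))
  have e : ⁅⁅(X : G), (Y : G)⁆, (Z : G)⁆ * ⁅⁅(Y : G), (Z : G)⁆, (X : G)⁆ *
      ⁅⁅(Z : G), (X : G)⁆, (Y : G)⁆ = 1 :=
    congrArg Subtype.val (tripleCommutator_jacobi hK X Y Z)
  have e' := congrArg (fun g : G ↦ ⁅g, t⁆) e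
  beta_reduce at e'
  rw [h.commutator_mul_left t ((hc Z X Y X Y Z).mul_right (hc Z X Y Y Z X)),
    h.commutator_mul_left t (hc Y Z X X Y Z), h₁, h₂, commutatorElement_one_left] at e'
  rw [pow_three, e']

end ThreeGeneratorClassThree

theorem mainTheorem2 (p : ℕ) (hp : p.Prime) (hp3 : 3 < p)
    (G : Type u) [Group G]
    (hcat : IsOmegaCategoricalGroup G)
    (hexp : Monoid.exponent G = p)
    (hclass : ∀ a b c : G,
      IsNilpotentOfClassLE (Subgroup.closure ({a, b, c} : Set G)) 3) :
    Group.IsNilpotent G := by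
  have h := ThreeGeneratorClassThree.of_isNilpotentOfClassLE hclass
  refine ⟨3, upperCentralSeries_three_eq_top_iff.mpr fun x y z t ↦ ?_⟩
  have hcop : Nat.Coprime 3 p :=
    (Nat.coprime_primes Nat.prime_three hp).mpr hp3.ne
  rw [← orderOf_eq_one_iff]
  exact Nat.eq_one_of_dvd_coprimes hcop
    (orderOf_dvd_of_pow_eq_one (h.commutator_pow_three_eq_one x y z t))
    (hexp ▸ Monoid.order_dvd_exponent _)
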